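/- For $s\in\mathbb R$ let $J^s=(1-\partial_x^2)^{s/2}$ be the operator on tempered distributions on $\mathbb R$ with Fourier multiplier $(1+4\pi^2\xi^2)^{s/2}$, where $\widehat f(\xi)=\int_{\mathbb R} f(x)e^{-2\pi i x\xi}\,dx$. For an open set $U\subset\mathbb R$, a tempered distribution $u$ is said to be in $L^2(U)$ if its restriction to $U$ is a function in $L^2(U)$. **Proposition.** Let $a\in\mathbb R$, $s>0$ and $f\in L^2(\mathbb R)$ (complex-valued), and suppose that $J^sf\in L^2(\{x>a\})$. Then for every $\varepsilon>0$ and every $r\in(0,s]$, $$J^rf\in L^2(\{x>a+\varepsilon\}).$$ -/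

import Mathlib

open MeasureTheory Set
open scoped SchwartzMap ENNReal

noncomputable section

namespace OneSidedRegularity

/-- The symbol `(1 + (2πξ)²)^(s/2)` of the operator `(1 - ∂ₓ²)^(s/2)`, for the Fourier transform
`∫ f(x) exp(-2πi x ξ) dx`. -/
def besselSymbol (s : ℝ) (ξ : ℝ) : ℂ :=
  (((1 + (2 * Real.pi * ξ) ^ 2) ^ (s / 2) : ℝ) : ℂ)

/-- The symbol has temperate growth, so that multiplication by it is defined on tempered
distributions. -/
theorem besselSymbol_hasTemperateGrowth (s : ℝ) :
    (besselSymbol s).HasTemperateGrowth := by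
  have h : (besselSymbol s) =
      (fun x : ℝ ↦ (((1 + ‖x‖ ^ 2) ^ (s / 2) : ℝ) : ℂ)) ∘ fun ξ : ℝ ↦ (2 * Real.pi) * ξ := by
    ext ξ
    simp [besselSymbol]
  rw [h]
  exact Function.HasTemperateGrowth.comp (by fun_prop) (by fun_prop)

/-- The operator `J^s = (1 - ∂ₓ²)^(s/2)` on tempered distributions on the real line. (Mathlib's
`besselPotential` is the operator `(1 - (2π)⁻² ∂ₓ²)^(s/2)` instead.) -/
def besselJ (s : ℝ) : 𝓢'(ℝ, ℂ) →L[ℂ] 𝓢'(ℝ, ℂ) :=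
  TemperedDistribution.fourierMultiplierCLM ℂ (besselSymbol s)

/-- `u ∈ L²(U)` for a tempered distribution `u` and an open set `U`: the restriction of `u` to `U`
(its action on smooth functions with compact support in `U`) is given by a function in `L²(U)`. -/
def MemL2On (u : 𝓢'(ℝ, ℂ)) (U : Set ℝ) : Prop :=
  ∃ g : ℝ → ℂ, MemLp g 2 (volume.restrict U) ∧
    ∀ φ : 𝓢(ℝ, ℂ), HasCompactSupport φ → tsupport φ ⊆ U →
      u φ = ∫ x in U, φ x * g x

end OneSidedRegularity

end

noncomputable section

namespace OneSidedRegularity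

open FourierTransform

/-! Choose `θ` supported near `0` with `θ 0 = 1`, and put `ψ = 𝓕⁻ θ`, so that `∫ ψ = 1`. A
multiplier with symbol `ψ * h` has its kernel cut off by `θ`, so it enlarges supports by at most `ε
/ 2` (`transposeMultiplier_smoothing_eq_zero`). For a symbol `m` of order `μ ≤ 0`, the difference `m
- ψ * m` has order `μ - 1`; iterating gives `m = ψ * h + e` with `e` of order as low as desired
(`IsSymbol.exists_smoothing_add`).

Applied to the symbol of order `r - s`, this writes `J^r` as `J^s` composed with a bounded local
operator, plus a bounded operator (`exists_local_factor`). Tested against `φ` supported in `x > a +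
ε`, the first term only sees `J^s f` on `x > a`, and the second is controlled by `f ∈ L²`. Hence
`J^r f` is `L²`-bounded on such `φ`, and the Riesz representation theorem concludes
(`memL2On_of_norm_le`). -/

/-! ### Symbols of order `μ` -/

/-- A sequence of successive derivatives `m 0, m 1, …` of a symbol of order `μ`. -/
structure IsSymbol (μ : ℝ) (m : ℕ → ℝ → ℂ) : Prop where
  hasDerivAt : ∀ j ξ, HasDerivAt (m j) (m (j + 1) ξ) ξ
  bound : ∀ j, ∃ C, ∀ ξ, ‖m j ξ‖ ≤ C * (1 + |ξ|) ^ (μ - j)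

/-- The convolution of `ψ` with `g`. -/
def smoothing (ψ : 𝓢(ℝ, ℂ)) (g : ℝ → ℂ) (ξ : ℝ) : ℂ :=
  ∫ ζ, ψ ζ * g (ξ - ζ)

/-- Peetre's inequality: it moves a weight from one point to another at a cost depending only on
their difference. -/
lemma one_add_abs_rpow_le (ν ξ η : ℝ) :
    (1 + |η|) ^ ν ≤ (1 + |ξ|) ^ ν * (1 + |ξ - η|) ^ |ν| := by
  have key : ∀ a b : ℝ, 1 + |a| ≤ (1 + |b|) * (1 + |b - a|) := fun a b ↦ by
    have h := abs_sub_abs_le_abs_sub a b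
    rw [abs_sub_comm] at h
    nlinarith [mul_nonneg (abs_nonneg b) (abs_nonneg (b - a))]
  rcases le_total 0 ν with h | h
  · rw [abs_of_nonneg h, ← Real.mul_rpow (by positivity) (by positivity)]
    exact Real.rpow_le_rpow (by positivity) (key η ξ) h
  · rw [abs_of_nonpos h, Real.rpow_neg (by positivity), ← div_eq_mul_inv,
      ← Real.div_rpow (by positivity) (by positivity)]
    refine Real.rpow_le_rpow_of_nonpos (by positivity) ?_ h
    rw [div_le_iff₀ (by positivity)]
    simpa [abs_sub_comm] using key ξ η

lemma IsSymbol.mono {μ ν : ℝ} {m : ℕ → ℝ → ℂ} (hm : IsSymbol μ m) (h : μ ≤ ν) :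
    IsSymbol ν m := by
  refine ⟨hm.hasDerivAt, fun j ↦ ?_⟩
  obtain ⟨C, hC⟩ := hm.bound j
  refine ⟨|C|, fun ξ ↦ (hC ξ).trans ?_⟩
  gcongr
  · exact le_abs_self C
  · linarith [abs_nonneg ξ]

lemma IsSymbol.add {μ : ℝ} {m n : ℕ → ℝ → ℂ} (hm : IsSymbol μ m) (hn : IsSymbol μ n) :
    IsSymbol μ (m + n) := by
  refine ⟨fun j ξ ↦ (hm.hasDerivAt j ξ).add (hn.hasDerivAt j ξ), fun j ↦ ?_⟩
  obtain ⟨C, hC⟩ := hm.bound j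
  obtain ⟨D, hD⟩ := hn.bound j
  exact ⟨C + D, fun ξ ↦ (norm_add_le _ _).trans (by linarith [hC ξ, hD ξ])⟩

lemma IsSymbol.zero (μ : ℝ) : IsSymbol μ 0 :=
  ⟨fun _ ξ ↦ hasDerivAt_const ξ 0, fun _ ↦ ⟨0, fun _ ↦ by simp⟩⟩

lemma IsSymbol.bounded {μ : ℝ} {m : ℕ → ℝ → ℂ} (hm : IsSymbol μ m) (hμ : μ ≤ 0) (j : ℕ) :
    ∃ C, 0 ≤ C ∧ ∀ ξ, ‖m j ξ‖ ≤ C := by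
  obtain ⟨C, hC⟩ := hm.bound j
  refine ⟨|C|, abs_nonneg C, fun ξ ↦ (hC ξ).trans ?_⟩
  have h1 : (1 + |ξ|) ^ (μ - j) ≤ 1 :=
    Real.rpow_le_one_of_one_le_of_nonpos (by linarith [abs_nonneg ξ])
      (by linarith [j.cast_nonneg (α := ℝ)])
  exact (mul_le_mul (le_abs_self C) h1 (by positivity) (abs_nonneg C)).trans_eq (mul_one _)

lemma IsSymbol.continuous {μ : ℝ} {m : ℕ → ℝ → ℂ} (hm : IsSymbol μ m) (j : ℕ) :
    Continuous (m j) :=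
  continuous_iff_continuousAt.2 fun ξ ↦ (hm.hasDerivAt j ξ).continuousAt

/-- Bounded successive derivatives give a function of temperate growth. -/
lemma hasTemperateGrowth_of_hasDerivAt {m : ℕ → ℝ → ℂ}
    (hd : ∀ j ξ, HasDerivAt (m j) (m (j + 1) ξ) ξ) (hb : ∀ j, ∃ C, ∀ ξ, ‖m j ξ‖ ≤ C) :
    (m 0).HasTemperateGrowth := by
  have h : ∀ n, iteratedDeriv n (m 0) = m n := fun n ↦ by
    induction n with
    | zero => exact iteratedDeriv_zero
    | succ n ih => rw [iteratedDeriv_succ, ih]; exact funext fun ξ ↦ (hd n ξ).deriv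
  refine ⟨contDiff_of_differentiable_iteratedDeriv fun n _ ↦ ?_, fun n ↦ ?_⟩
  · rw [h n]; exact fun ξ ↦ (hd n ξ).differentiableAt
  · obtain ⟨C, hC⟩ := hb n
    exact ⟨0, C, fun ξ ↦ by
      simpa [norm_iteratedFDeriv_eq_norm_iteratedDeriv, h n] using hC ξ⟩

/-! ### Smoothing of symbols by convolution -/

lemma integrable_smoothing_integrand (ψ : 𝓢(ℝ, ℂ)) {g : ℝ → ℂ} (hg : Continuous g) {C : ℝ}
    (hC : ∀ ξ, ‖g ξ‖ ≤ C) (ξ : ℝ) : Integrable fun ζ ↦ ψ ζ * g (ξ - ζ) := by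
  refine ψ.integrable.mul_bdd (c := C) ?_ (.of_forall fun ζ ↦ hC _)
  exact (hg.comp (by fun_prop)).aestronglyMeasurable

lemma norm_smoothing_le (ψ : 𝓢(ℝ, ℂ)) {g : ℝ → ℂ} {C : ℝ} (hC : ∀ ξ, ‖g ξ‖ ≤ C) (ξ : ℝ) :
    ‖smoothing ψ g ξ‖ ≤ ∫ ζ, ‖ψ ζ‖ * C := by
  refine norm_integral_le_of_norm_le (ψ.integrable.norm.mul_const C) (.of_forall fun ζ ↦ ?_)
  rw [norm_mul]
  gcongr
  exact hC _

lemma hasDerivAt_smoothing (ψ : 𝓢(ℝ, ℂ)) {g g' : ℝ → ℂ} (hd : ∀ ξ, HasDerivAt g (g' ξ) ξ)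
    (hg' : Continuous g') {C D : ℝ} (hC : ∀ ξ, ‖g ξ‖ ≤ C) (hD : ∀ ξ, ‖g' ξ‖ ≤ D) (ξ : ℝ) :
    HasDerivAt (smoothing ψ g) (smoothing ψ g' ξ) ξ := by
  have hg : Continuous g := continuous_iff_continuousAt.2 fun ξ ↦ (hd ξ).continuousAt
  refine (hasDerivAt_integral_of_dominated_loc_of_deriv_le (s := univ)
    (F := fun ξ ζ ↦ ψ ζ * g (ξ - ζ)) (F' := fun ξ ζ ↦ ψ ζ * g' (ξ - ζ))
    (bound := fun ζ ↦ ‖ψ ζ‖ * D) Filter.univ_mem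
    (.of_forall fun x ↦ (integrable_smoothing_integrand ψ hg hC x).aestronglyMeasurable)
    (integrable_smoothing_integrand ψ hg hC ξ)
    (integrable_smoothing_integrand ψ hg' hD ξ).aestronglyMeasurable
    (.of_forall fun ζ x _ ↦ ?_) (ψ.integrable.norm.mul_const D)
    (.of_forall fun ζ x _ ↦ ?_)).2
  · rw [norm_mul]
    gcongr
    exact hD _
  · exact ((hd (x - ζ)).comp_sub_const x ζ).const_mul (ψ ζ)

lemma smoothing_add (ψ : 𝓢(ℝ, ℂ)) {g h : ℝ → ℂ} (hg : Continuous g) (hh : Continuous h)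
    {C D : ℝ} (hC : ∀ ξ, ‖g ξ‖ ≤ C) (hD : ∀ ξ, ‖h ξ‖ ≤ D) (ξ : ℝ) :
    smoothing ψ (g + h) ξ = smoothing ψ g ξ + smoothing ψ h ξ := by
  rw [smoothing, smoothing, smoothing, ← integral_add (integrable_smoothing_integrand ψ hg hC ξ)
    (integrable_smoothing_integrand ψ hh hD ξ)]
  simp [mul_add]

lemma integrable_weight (ψ : 𝓢(ℝ, ℂ)) (β : ℝ) :
    Integrable fun ζ ↦ ‖ψ ζ‖ * (|ζ| * (1 + |ζ|) ^ β) := by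
  obtain ⟨k, hk⟩ := exists_nat_ge β
  have hint : Integrable fun ζ ↦ 2 ^ k * (‖ζ‖ ^ 1 * ‖ψ ζ‖ + ‖ζ‖ ^ (k + 1) * ‖ψ ζ‖) :=
    ((ψ.integrable_pow_mul volume 1).add (ψ.integrable_pow_mul volume (k + 1))).const_mul _
  refine hint.mono' ?_ (.of_forall fun ζ ↦ ?_)
  · refine Continuous.aestronglyMeasurable ?_
    have h : Continuous fun ζ : ℝ ↦ (1 + |ζ|) ^ β :=
      Continuous.rpow_const (by fun_prop) fun ζ ↦ Or.inl (by positivity)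
    have := ψ.continuous
    fun_prop
  · have hp : (1 + |ζ|) ^ β ≤ 2 ^ k * (1 + |ζ| ^ k) := by
      calc (1 + |ζ|) ^ β ≤ (1 + |ζ|) ^ (k : ℝ) := by
            gcongr
            linarith [abs_nonneg ζ]
        _ = (1 + |ζ|) ^ k := Real.rpow_natCast _ _
        _ ≤ 2 ^ (k - 1) * (1 ^ k + |ζ| ^ k) := add_pow_le zero_le_one (abs_nonneg ζ) k
        _ ≤ 2 ^ k * (1 + |ζ| ^ k) := by
            rw [one_pow]
            gcongr
            · norm_num
            · omega
    rw [Real.norm_of_nonneg (by positivity), Real.norm_eq_abs]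
    calc ‖ψ ζ‖ * (|ζ| * (1 + |ζ|) ^ β) ≤ ‖ψ ζ‖ * (|ζ| * (2 ^ k * (1 + |ζ| ^ k))) := by gcongr
      _ = _ := by ring

/-- Subtracting the smoothing gains one order of decay. -/
lemma norm_sub_smoothing_le (ψ : 𝓢(ℝ, ℂ)) (hψ : ∫ ζ, ψ ζ = 1) {g g' : ℝ → ℂ}
    (hd : ∀ ξ, HasDerivAt g (g' ξ) ξ) {B C ν : ℝ} (hB : ∀ ξ, ‖g ξ‖ ≤ B) (hC0 : 0 ≤ C)
    (hC : ∀ ξ, ‖g' ξ‖ ≤ C * (1 + |ξ|) ^ ν) :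
    ∃ D, ∀ ξ, ‖g ξ - smoothing ψ g ξ‖ ≤ D * (1 + |ξ|) ^ ν := by
  have hg : Continuous g := continuous_iff_continuousAt.2 fun ξ ↦ (hd ξ).continuousAt
  refine ⟨C * ∫ ζ, ‖ψ ζ‖ * (|ζ| * (1 + |ζ|) ^ |ν|), fun ξ ↦ ?_⟩
  -- Mean value inequality on the segment from `ξ - ζ` to `ξ`; Peetre's inequality moves the weight
  -- to the endpoint `ξ`.
  have hlip : ∀ ζ, ‖g ξ - g (ξ - ζ)‖ ≤ C * ((1 + |ξ|) ^ ν * (1 + |ζ|) ^ |ν|) * |ζ| := fun ζ ↦ by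
    have := (convex_uIcc (ξ - ζ) ξ).norm_image_sub_le_of_norm_hasDerivWithin_le
      (f := g) (f' := g') (C := C * ((1 + |ξ|) ^ ν * (1 + |ζ|) ^ |ν|))
      (fun x _ ↦ (hd x).hasDerivWithinAt) (fun x hx ↦ ?_) left_mem_uIcc right_mem_uIcc
    · simpa using this
    · refine (hC x).trans ?_
      gcongr
      refine (one_add_abs_rpow_le ν ξ x).trans ?_
      have hx' : |ξ - x| ≤ |ζ| := by simpa using abs_sub_right_of_mem_uIcc hx
      gcongr (1 + |ξ|) ^ ν * (1 + ?_) ^ |ν|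
  have heq : g ξ - smoothing ψ g ξ = ∫ ζ, ψ ζ * (g ξ - g (ξ - ζ)) := by
    simp_rw [mul_sub]
    rw [integral_sub (ψ.integrable.mul_const _) (integrable_smoothing_integrand ψ hg hB ξ),
      integral_mul_const, hψ, one_mul, smoothing]
  rw [heq]
  refine (norm_integral_le_of_norm_le
    (((integrable_weight ψ |ν|).const_mul C).mul_const ((1 + |ξ|) ^ ν))
    (.of_forall fun ζ ↦ ?_)).trans_eq ?_
  · rw [norm_mul]
    calc ‖ψ ζ‖ * ‖g ξ - g (ξ - ζ)‖
        ≤ ‖ψ ζ‖ * (C * ((1 + |ξ|) ^ ν * (1 + |ζ|) ^ |ν|) * |ζ|) := by gcongr; exact hlip ζ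
      _ = _ := by ring
  · rw [integral_mul_const, integral_const_mul]

/-- Smoothing commutes with differentiation, so the gain of one order applies to every derivative.
-/
lemma IsSymbol.sub_smoothing (ψ : 𝓢(ℝ, ℂ)) (hψ : ∫ ζ, ψ ζ = 1) {μ : ℝ} (hμ : μ ≤ 0)
    {m : ℕ → ℝ → ℂ} (hm : IsSymbol μ m) :
    IsSymbol (μ - 1) fun j ξ ↦ m j ξ - smoothing ψ (m j) ξ := by
  refine ⟨fun j ξ ↦ ?_, fun j ↦ ?_⟩
  · obtain ⟨C, -, hC⟩ := hm.bounded hμ j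
    obtain ⟨D, -, hD⟩ := hm.bounded hμ (j + 1)
    exact (hm.hasDerivAt j ξ).sub
      (hasDerivAt_smoothing ψ (hm.hasDerivAt j) (hm.continuous _) hC hD ξ)
  · obtain ⟨B, -, hB⟩ := hm.bounded hμ j
    obtain ⟨C, hC⟩ := hm.bound (j + 1)
    refine norm_sub_smoothing_le ψ hψ (hm.hasDerivAt j) hB (abs_nonneg C) fun ξ ↦ (hC ξ).trans ?_
    rw [show μ - ((j + 1 : ℕ) : ℝ) = μ - 1 - j by push_cast; ring]
    gcongr
    exact le_abs_self C

/-- A symbol of nonpositive order is a smoothing of a symbol plus a symbol of very low order. -/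
lemma IsSymbol.exists_smoothing_add (ψ : 𝓢(ℝ, ℂ)) (hψ : ∫ ζ, ψ ζ = 1) {μ : ℝ} (hμ : μ ≤ 0)
    {m : ℕ → ℝ → ℂ} (hm : IsSymbol μ m) (k : ℕ) :
    ∃ h e, IsSymbol μ h ∧ IsSymbol (μ - k) e ∧ ∀ ξ, m 0 ξ = smoothing ψ (h 0) ξ + e 0 ξ := by
  induction k with
  | zero =>
    exact ⟨0, m, .zero μ, by simpa using hm, fun ξ ↦ by simp [smoothing]⟩
  | succ k ih =>
    obtain ⟨h, e, hh, he, heq⟩ := ih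
    have hk : μ - k ≤ 0 := by linarith [k.cast_nonneg (α := ℝ)]
    -- Split the error as `e = ψ * e + (e - ψ * e)` and absorb the first part into the smoothing.
    refine ⟨h + e, fun j ξ ↦ e j ξ - smoothing ψ (e j) ξ, hh.add (he.mono (by linarith [k.cast_nonneg (α := ℝ)])), ?_, fun ξ ↦ ?_⟩
    · convert! he.sub_smoothing ψ hψ hk using 1
      push_cast; ring
    · obtain ⟨C, -, hC⟩ := hh.bounded hμ 0
      obtain ⟨D, -, hD⟩ := he.bounded hk 0
      rw [Pi.add_apply, smoothing_add ψ (hh.continuous 0) (he.continuous 0) hC hD, heq ξ]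
      ring

lemma IsSymbol.smoothing_bounded (ψ : 𝓢(ℝ, ℂ)) {μ : ℝ} (hμ : μ ≤ 0)
    {m : ℕ → ℝ → ℂ} (hm : IsSymbol μ m) (j : ℕ) : ∃ C, ∀ ξ, ‖smoothing ψ (m j) ξ‖ ≤ C := by
  obtain ⟨C, -, hC⟩ := hm.bounded hμ j
  exact ⟨_, norm_smoothing_le ψ hC⟩

lemma IsSymbol.smoothing_hasTemperateGrowth (ψ : 𝓢(ℝ, ℂ)) {μ : ℝ} (hμ : μ ≤ 0)
    {m : ℕ → ℝ → ℂ} (hm : IsSymbol μ m) : (smoothing ψ (m 0)).HasTemperateGrowth := by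
  refine hasTemperateGrowth_of_hasDerivAt (m := fun j ↦ smoothing ψ (m j)) (fun j ξ ↦ ?_)
    (hm.smoothing_bounded ψ hμ)
  obtain ⟨C, -, hC⟩ := hm.bounded hμ j
  obtain ⟨D, -, hD⟩ := hm.bounded hμ (j + 1)
  exact hasDerivAt_smoothing ψ (hm.hasDerivAt j) (hm.continuous _) hC hD ξ

/-! ### The Bessel symbols -/

lemma one_add_sq_rpow_le (β : ℝ) : ∃ C, 0 ≤ C ∧ ∀ ξ : ℝ,
    (1 + (2 * Real.pi * ξ) ^ 2) ^ β ≤ C * (1 + |ξ|) ^ (2 * β) := by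
  have hpi := Real.pi_gt_three
  have hsq : ∀ ξ : ℝ, (1 + |ξ|) ^ (2 * β) = ((1 + |ξ|) ^ 2) ^ β := fun ξ ↦ by
    rw [Real.rpow_mul (by positivity), Real.rpow_two]
  have h1 : ∀ ξ : ℝ, 1 + (2 * Real.pi * ξ) ^ 2 ≤ (2 * Real.pi) ^ 2 * (1 + |ξ|) ^ 2 := fun ξ ↦ by
    rw [mul_pow, ← sq_abs ξ]
    nlinarith [abs_nonneg ξ, mul_nonneg (sq_nonneg (2 * Real.pi)) (abs_nonneg ξ)]
  have h2 : ∀ ξ : ℝ, 2⁻¹ * (1 + |ξ|) ^ 2 ≤ 1 + (2 * Real.pi * ξ) ^ 2 := fun ξ ↦ by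
    rw [mul_pow, ← sq_abs ξ]
    have : 1 ≤ (2 * Real.pi) ^ 2 := by nlinarith
    nlinarith [sq_nonneg (1 - |ξ|), mul_le_mul_of_nonneg_right this (sq_nonneg |ξ|)]
  rcases le_total 0 β with h | h
  · refine ⟨((2 * Real.pi) ^ 2) ^ β, by positivity, fun ξ ↦ ?_⟩
    rw [hsq, ← Real.mul_rpow (by positivity) (by positivity)]
    exact Real.rpow_le_rpow (by positivity) (h1 ξ) h
  · refine ⟨2⁻¹ ^ β, by positivity, fun ξ ↦ ?_⟩
    rw [hsq, ← Real.mul_rpow (by positivity) (by positivity)]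
    exact Real.rpow_le_rpow_of_nonpos (by positivity) (h2 ξ) h

lemma norm_besselSymbol_le (s : ℝ) : ∃ C, 0 ≤ C ∧ ∀ ξ, ‖besselSymbol s ξ‖ ≤ C * (1 + |ξ|) ^ s := by
  obtain ⟨C, hC0, hC⟩ := one_add_sq_rpow_le (s / 2)
  refine ⟨C, hC0, fun ξ ↦ ?_⟩
  rw [besselSymbol, Complex.norm_real, Real.norm_of_nonneg (by positivity)]
  simpa [mul_div_cancel₀] using hC ξ

lemma abs_eval_le (P : Polynomial ℝ) {n : ℕ} (hn : P.natDegree ≤ n) :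
    ∃ C, 0 ≤ C ∧ ∀ ξ : ℝ, |P.eval ξ| ≤ C * (1 + |ξ|) ^ n := by
  refine ⟨∑ i ∈ Finset.range (n + 1), |P.coeff i|, by positivity, fun ξ ↦ ?_⟩
  rw [Polynomial.eval_eq_sum_range' (Nat.lt_succ_of_le hn), Finset.sum_mul]
  refine (Finset.abs_sum_le_sum_abs _ _).trans (Finset.sum_le_sum fun i hi ↦ ?_)
  rw [abs_mul, abs_pow]
  gcongr
  calc |ξ| ^ i ≤ (1 + |ξ|) ^ i := by gcongr; linarith
    _ ≤ (1 + |ξ|) ^ n := by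
      gcongr
      · linarith [abs_nonneg ξ]
      · exact Nat.lt_succ_iff.1 (Finset.mem_range.1 hi)

open Polynomial in
/-- The polynomial `P` such that the `j`-th derivative of `(1 + (2πξ)²)^α` is
`P(ξ) (1 + (2πξ)²)^(α - j)`. -/
def besselPolynomial (α : ℝ) : ℕ → ℝ[X]
  | 0 => 1
  | j + 1 => derivative (besselPolynomial α j) * (1 + C ((2 * Real.pi) ^ 2) * X ^ 2) +
      C ((α - j) * (2 * (2 * Real.pi) ^ 2)) * X * besselPolynomial α j

open Polynomial in
lemma natDegree_besselPolynomial_le (α : ℝ) (j : ℕ) : (besselPolynomial α j).natDegree ≤ j := by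
  induction j with
  | zero => simp [besselPolynomial]
  | succ j ih =>
    rw [besselPolynomial]
    refine natDegree_add_le_of_degree_le ?_ ?_
    · rcases Nat.eq_zero_or_pos j with rfl | hj
      · simp [besselPolynomial]
      · refine natDegree_mul_le.trans ?_
        have h1 := natDegree_derivative_le (besselPolynomial α j)
        have h2 : (1 + C ((2 * Real.pi) ^ 2) * X ^ 2 : ℝ[X]).natDegree ≤ 2 := by compute_degree
        omega
    · refine natDegree_mul_le.trans ?_
      have h2 : (C ((α - j) * (2 * (2 * Real.pi) ^ 2)) * X : ℝ[X]).natDegree ≤ 1 := by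
        compute_degree
      omega

lemma hasDerivAt_besselPolynomial (α : ℝ) (j : ℕ) (ξ : ℝ) :
    HasDerivAt (fun ξ ↦ (besselPolynomial α j).eval ξ * (1 + (2 * Real.pi * ξ) ^ 2) ^ (α - j))
      ((besselPolynomial α (j + 1)).eval ξ *
        (1 + (2 * Real.pi * ξ) ^ 2) ^ (α - (j + 1 : ℕ))) ξ := by
  have hpos : 0 < 1 + (2 * Real.pi * ξ) ^ 2 := by positivity
  have h1 : HasDerivAt (fun ξ : ℝ ↦ 1 + (2 * Real.pi * ξ) ^ 2) (2 * (2 * Real.pi) ^ 2 * ξ) ξ := by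
    have := ((((hasDerivAt_id ξ).const_mul (2 * Real.pi)).pow 2).const_add 1)
    convert! this using 1
    simp; ring
  convert! ((besselPolynomial α j).hasDerivAt ξ).mul
    (h1.rpow_const (p := α - j) (Or.inl hpos.ne')) using 1
  have h2 : (1 + (2 * Real.pi * ξ) ^ 2) ^ (α - j) =
      (1 + (2 * Real.pi * ξ) ^ 2) ^ (α - j - 1) * (1 + (2 * Real.pi * ξ) ^ 2) := by
    rw [← Real.rpow_add_one hpos.ne']; ring_nf
  rw [h2, show α - ((j + 1 : ℕ) : ℝ) = α - j - 1 by push_cast; ring, besselPolynomial]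
  simp
  ring

lemma exists_isSymbol_besselSymbol (s : ℝ) :
    ∃ m, IsSymbol s m ∧ m 0 = besselSymbol s := by
  refine ⟨fun j ξ ↦ (((besselPolynomial (s / 2) j).eval ξ *
    (1 + (2 * Real.pi * ξ) ^ 2) ^ (s / 2 - j) : ℝ) : ℂ), ⟨fun j ξ ↦ ?_, fun j ↦ ?_⟩, ?_⟩
  · exact (hasDerivAt_besselPolynomial (s / 2) j ξ).ofReal_comp
  · obtain ⟨A, hA0, hA⟩ := abs_eval_le _ (natDegree_besselPolynomial_le (s / 2) j)
    obtain ⟨B, hB0, hB⟩ := one_add_sq_rpow_le (s / 2 - j)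
    refine ⟨A * B, fun ξ ↦ ?_⟩
    rw [Complex.norm_real, norm_mul, Real.norm_eq_abs, Real.norm_of_nonneg (by positivity)]
    calc _ ≤ (A * (1 + |ξ|) ^ j) * (B * (1 + |ξ|) ^ (2 * (s / 2 - j))) :=
          mul_le_mul (hA ξ) (hB ξ) (by positivity) (by positivity)
      _ = A * B * ((1 + |ξ|) ^ (j : ℝ) * (1 + |ξ|) ^ (2 * (s / 2 - j))) := by
          rw [Real.rpow_natCast]; ring
      _ = _ := by
          rw [← Real.rpow_add (by positivity)]
          ring_nf
  · ext ξ
    simp [besselPolynomial, besselSymbol]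

lemma besselSymbol_mul (s t ξ : ℝ) :
    besselSymbol s ξ * besselSymbol t ξ = besselSymbol (s + t) ξ := by
  rw [besselSymbol, besselSymbol, besselSymbol, ← Complex.ofReal_mul,
    ← Real.rpow_add (by positivity)]
  ring_nf

/-! ### Multipliers on test functions: `L²` bounds and supports -/

/-- The Fourier multiplier with symbol `g (-ξ)`, which is the transpose of the one with symbol
`g`. -/
def transposeMultiplier (g : ℝ → ℂ) (φ : 𝓢(ℝ, ℂ)) : 𝓢(ℝ, ℂ) :=
  𝓕 (SchwartzMap.smulLeftCLM ℂ g (𝓕⁻ φ))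

lemma norm_transposeMultiplier_toLp_le {g : ℝ → ℂ} (hg : g.HasTemperateGrowth) {C : ℝ}
    (hC : ∀ ξ, ‖g ξ‖ ≤ C) (φ : 𝓢(ℝ, ℂ)) :
    ‖(transposeMultiplier g φ).toLp 2 volume‖ ≤ C * ‖φ.toLp 2 volume‖ := by
  have h : ‖φ.toLp 2 volume‖ = ‖(𝓕⁻ φ).toLp 2 volume‖ := by
    rw [← SchwartzMap.norm_fourier_toL2_eq (𝓕⁻ φ), fourier_fourierInv_eq]
  rw [transposeMultiplier, SchwartzMap.norm_fourier_toL2_eq, h]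
  refine Lp.norm_le_mul_norm_of_ae_le_mul ?_
  filter_upwards [SchwartzMap.coeFn_toLp (𝓕⁻ φ) 2 volume,
    SchwartzMap.coeFn_toLp (SchwartzMap.smulLeftCLM ℂ g (𝓕⁻ φ)) 2 volume] with ξ h1 h2
  rw [h1, h2, SchwartzMap.smulLeftCLM_apply_apply hg, norm_smul]
  gcongr
  exact hC ξ

lemma fourier_apply_eq (φ : 𝓢(ℝ, ℂ)) (x : ℝ) :
    𝓕 φ x = ∫ ξ : ℝ, Complex.exp (-(2 * Real.pi * Complex.I * x * ξ)) * φ ξ := by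
  rw [SchwartzMap.fourier_coe, Real.fourier_eq']
  congr 1; ext ξ
  simp only [smul_eq_mul]
  congr 2
  simp; ring

lemma fourierInv_apply_eq (φ : 𝓢(ℝ, ℂ)) (x : ℝ) :
    𝓕⁻ φ x = ∫ ξ : ℝ, Complex.exp (2 * Real.pi * Complex.I * x * ξ) * φ ξ := by
  rw [SchwartzMap.fourierInv_coe, Real.fourierInv_eq']
  congr 1; ext ξ
  simp only [smul_eq_mul]
  congr 2
  simp; ring

lemma norm_exp_two_pi_I (x y : ℝ) : ‖Complex.exp (2 * Real.pi * Complex.I * x * y)‖ = 1 := by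
  rw [show 2 * (Real.pi : ℂ) * Complex.I * x * y = ((2 * Real.pi * x * y : ℝ) : ℂ) * Complex.I by
    push_cast; ring, Complex.norm_exp_ofReal_mul_I]

lemma norm_exp_neg_two_pi_I (x y : ℝ) :
    ‖Complex.exp (-(2 * Real.pi * Complex.I * x * y))‖ = 1 := by
  simpa using norm_exp_two_pi_I (-x) y

/-- By Fubini and Fourier inversion the integral equals `∫ exp(-2πiηy) θ(y) φ(x - y) dy`. -/
lemma integral_translate_eq_zero (θ φ : 𝓢(ℝ, ℂ)) {x : ℝ} (h : ∀ y, θ y * φ (x - y) = 0) (η : ℝ) :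
    ∫ ξ : ℝ, Complex.exp (-(2 * Real.pi * Complex.I * x * ξ)) * (𝓕⁻ θ (ξ - η) * 𝓕⁻ φ ξ) = 0 := by
  let F : ℝ → ℝ → ℂ := fun ξ y ↦ (Complex.exp (-(2 * Real.pi * Complex.I * x * ξ)) *
    Complex.exp (2 * Real.pi * Complex.I * (ξ - η : ℝ) * y)) * (𝓕⁻ φ ξ * θ y)
  have hF : Integrable (Function.uncurry F) (volume.prod volume) := by
    refine ((𝓕⁻ φ).integrable.mul_prod θ.integrable).bdd_mul (c := 1) ?_ (.of_forall fun p ↦ ?_)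
    · refine Continuous.aestronglyMeasurable ?_
      fun_prop
    · rw [norm_mul, norm_exp_two_pi_I, norm_exp_neg_two_pi_I, one_mul]
  have h1 : ∀ ξ : ℝ, Complex.exp (-(2 * Real.pi * Complex.I * x * ξ)) * (𝓕⁻ θ (ξ - η) * 𝓕⁻ φ ξ) =
      ∫ y, F ξ y := fun ξ ↦ by
    rw [fourierInv_apply_eq θ, ← integral_mul_const, ← integral_const_mul]
    congr 1; ext y
    simp only [F]; ring
  simp_rw [h1]
  rw [integral_integral_swap hF]
  refine integral_eq_zero_of_ae (.of_forall fun y ↦ ?_)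
  have h2 : ∫ ξ, F ξ y = Complex.exp (-(2 * Real.pi * Complex.I * η * y)) *
      (θ y * 𝓕 (𝓕⁻ φ) (x - y)) := by
    rw [fourier_apply_eq, ← integral_const_mul, ← integral_const_mul]
    congr 1; ext ξ
    have : Complex.exp (-(2 * Real.pi * Complex.I * x * ξ)) *
        Complex.exp (2 * Real.pi * Complex.I * (ξ - η : ℝ) * y) =
        Complex.exp (-(2 * Real.pi * Complex.I * η * y)) *
        Complex.exp (-(2 * Real.pi * Complex.I * (x - y : ℝ) * ξ)) := by
      rw [← Complex.exp_add, ← Complex.exp_add]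
      congr 1
      push_cast; ring
    simp only [F, this]; ring
  simp only [Pi.zero_apply]
  rw [h2, fourier_fourierInv_eq, h y, mul_zero]

/-- The multiplier whose symbol is a smoothing by `𝓕⁻ θ` enlarges supports by at most the support
of `θ`. -/
lemma transposeMultiplier_smoothing_eq_zero (θ φ : 𝓢(ℝ, ℂ)) {h : ℝ → ℂ} (hh : Continuous h)
    {C : ℝ} (hC : ∀ ξ, ‖h ξ‖ ≤ C) (hp : (smoothing (𝓕⁻ θ) h).HasTemperateGrowth) {x : ℝ}
    (hx : ∀ y, θ y * φ (x - y) = 0) :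
    transposeMultiplier (smoothing (𝓕⁻ θ) h) φ x = 0 := by
  -- The symbol is a superposition over `η` of translates of `𝓕⁻ θ`; each translate already
  -- contributes zero at `x`.
  let F : ℝ → ℝ → ℂ := fun ξ η ↦ (Complex.exp (-(2 * Real.pi * Complex.I * x * ξ)) * h η) *
    (𝓕⁻ φ ξ * 𝓕⁻ θ (ξ - η))
  have hF : Integrable (Function.uncurry F) (volume.prod volume) := by
    have h0 := (Integrable.convolution_integrand (ContinuousLinearMap.mul ℝ ℂ)
      (𝓕⁻ φ).integrable (μ := volume) (ν := volume) (𝓕⁻ θ).integrable.comp_neg).swap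
    have h1 : Integrable (fun p : ℝ × ℝ ↦ 𝓕⁻ φ p.1 * 𝓕⁻ θ (p.1 - p.2))
        (volume.prod volume) := by
      refine h0.congr (.of_forall fun p ↦ ?_)
      simp
    refine h1.bdd_mul (c := C) ?_ (.of_forall fun p ↦ ?_)
    · refine Continuous.aestronglyMeasurable ?_
      fun_prop
    · rw [norm_mul, norm_exp_neg_two_pi_I, one_mul]
      exact hC _
  have h1 : ∀ ξ, smoothing (𝓕⁻ θ) h ξ = ∫ η, 𝓕⁻ θ (ξ - η) * h η := fun ξ ↦ by
    rw [smoothing, ← integral_sub_left_eq_self _ _ ξ]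
    simp
  rw [transposeMultiplier, fourier_apply_eq]
  have h2 : ∀ ξ : ℝ, Complex.exp (-(2 * Real.pi * Complex.I * x * ξ)) *
      SchwartzMap.smulLeftCLM ℂ (smoothing (𝓕⁻ θ) h) (𝓕⁻ φ) ξ = ∫ η, F ξ η := fun ξ ↦ by
    rw [SchwartzMap.smulLeftCLM_apply_apply hp, smul_eq_mul, h1, ← integral_mul_const,
      ← integral_const_mul]
    congr 1; ext η
    simp only [F]; ring
  simp_rw [h2]
  rw [integral_integral_swap hF]
  refine integral_eq_zero_of_ae (.of_forall fun η ↦ ?_)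
  have h3 : ∫ ξ, F ξ η = h η * ∫ ξ : ℝ, Complex.exp (-(2 * Real.pi * Complex.I * x * ξ)) *
      (𝓕⁻ θ (ξ - η) * 𝓕⁻ φ ξ) := by
    rw [← integral_const_mul]
    congr 1; ext ξ
    simp only [F]; ring
  simp only [Pi.zero_apply]
  rw [h3, integral_translate_eq_zero θ φ hx, mul_zero]

/-! ### Duality in `L²` -/

/-- A distribution that is bounded for the `L²` norm on the test functions supported in `U` is in
`L²(U)`. -/
lemma memL2On_of_norm_le {u : 𝓢'(ℝ, ℂ)} {U : Set ℝ} {C : ℝ}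
    (h : ∀ φ : 𝓢(ℝ, ℂ), HasCompactSupport φ → tsupport φ ⊆ U → ‖u φ‖ ≤ C * ‖φ.toLp 2 volume‖) :
    MemL2On u U := by
  let S : Submodule ℂ 𝓢(ℝ, ℂ) :=
    { carrier := {φ | HasCompactSupport φ ∧ tsupport φ ⊆ U}
      zero_mem' := by
        refine ⟨HasCompactSupport.zero, ?_⟩
        simp [FunLike.coe_zero]
      add_mem' := fun {φ χ} hφ hχ ↦
        ⟨hφ.1.add hχ.1, (tsupport_add φ χ).trans (union_subset hφ.2 hχ.2)⟩
      smul_mem' := fun c φ hφ ↦ ⟨hφ.1.smul_left (f := fun _ ↦ c),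
        (tsupport_smul_subset_right (fun _ ↦ c) φ).trans hφ.2⟩ }
  let T : S →ₗ[ℂ] Lp ℂ 2 (volume : Measure ℝ) :=
    (SchwartzMap.toLpCLM ℂ ℂ 2 volume).toLinearMap ∘ₗ S.subtype
  have hT : Function.Injective T := fun φ χ hφχ ↦
    Subtype.ext (SchwartzMap.injective_toLp 2 volume hφχ)
  let e := LinearEquiv.ofInjective T hT
  -- Injectivity of `T` makes `u` a well-defined functional on the image in `L²`, which Hahn–Banach
  -- then extends.
  let l : StrongDual ℂ (LinearMap.range T) :=
    (u.toLinearMap ∘ₗ S.subtype ∘ₗ e.symm.toLinearMap).mkContinuous C fun v ↦ by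
      obtain ⟨φ, rfl⟩ := e.surjective v
      change ‖u (S.subtype (e.symm (e φ)))‖ ≤ _
      rw [e.symm_apply_apply φ]
      exact h φ φ.2.1 φ.2.2
  obtain ⟨L, hL, -⟩ := exists_extension_norm_eq _ l
  let v := (InnerProductSpace.toDual ℂ (Lp ℂ 2 (volume : Measure ℝ))).symm L
  -- The inner product is conjugate-linear in its first slot, whereas the pairing is bilinear; hence
  -- `star`.
  refine ⟨star (v : ℝ → ℂ), (Lp.memLp v).star.restrict U, fun φ hφ hφU ↦ ?_⟩
  let φ' : S := ⟨φ, hφ, hφU⟩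
  have h1 : u φ = L (φ.toLp 2 volume) := by
    have h2 : L (e φ') = l (e φ') := hL (e φ')
    have h3 : l (e φ') = u φ := by
      change u (S.subtype (e.symm (e φ'))) = _
      rw [e.symm_apply_apply φ']
      rfl
    exact h3.symm.trans h2.symm
  rw [h1, ← InnerProductSpace.toDual_symm_apply, L2.inner_def,
    setIntegral_eq_integral_of_forall_compl_eq_zero fun x hx ↦ by
      rw [image_eq_zero_of_notMem_tsupport fun hx' ↦ hx (hφU hx'), zero_mul]]
  refine integral_congr_ae ?_
  filter_upwards [SchwartzMap.coeFn_toLp φ 2 volume] with x hx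
  rw [hx]
  simp [v]

lemma besselJ_apply (s : ℝ) (u : 𝓢'(ℝ, ℂ)) (φ : 𝓢(ℝ, ℂ)) :
    besselJ s u φ = u (transposeMultiplier (besselSymbol s) φ) := rfl

lemma transposeMultiplier_mul {g h : ℝ → ℂ} (hg : g.HasTemperateGrowth)
    (hh : h.HasTemperateGrowth) (φ : 𝓢(ℝ, ℂ)) :
    transposeMultiplier (g * h) φ = transposeMultiplier g (transposeMultiplier h φ) := by
  rw [transposeMultiplier, transposeMultiplier, transposeMultiplier, fourierInv_fourier_eq,
    SchwartzMap.smulLeftCLM_smulLeftCLM_apply hg hh]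

lemma transposeMultiplier_add {g h : ℝ → ℂ} (hg : g.HasTemperateGrowth)
    (hh : h.HasTemperateGrowth) (φ : 𝓢(ℝ, ℂ)) :
    transposeMultiplier (g + h) φ = transposeMultiplier g φ + transposeMultiplier h φ := by
  rw [transposeMultiplier, SchwartzMap.smulLeftCLM_add hg hh, add_apply,
    FourierTransform.fourier_add]
  rfl

/-! ### Local factorization and conclusion -/

lemma exists_schwartz_bump {δ : ℝ} (hδ : 0 < δ) :
    ∃ θ : 𝓢(ℝ, ℂ), θ 0 = 1 ∧ ∀ y, δ ≤ |y| → θ y = 0 := by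
  let b : ContDiffBump (0 : ℝ) := ⟨δ / 2, δ, by positivity, by linarith⟩
  have hc : HasCompactSupport fun y ↦ ((b y : ℝ) : ℂ) :=
    b.hasCompactSupport.comp_left Complex.ofReal_zero
  have hd : ContDiff ℝ ((⊤ : ℕ∞) : WithTop ℕ∞) fun y ↦ ((b y : ℝ) : ℂ) :=
    Complex.ofRealCLM.contDiff.comp b.contDiff
  refine ⟨hc.toSchwartzMap hd, ?_, fun y hy ↦ ?_⟩
  · change ((b 0 : ℝ) : ℂ) = 1
    rw [b.one_of_mem_closedBall (by simpa using b.rIn_pos.le), Complex.ofReal_one]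
  · change ((b y : ℝ) : ℂ) = 0
    rw [b.zero_of_le_dist (by simpa [b, Real.dist_eq] using hy), Complex.ofReal_zero]

lemma integral_fourierInv (θ : 𝓢(ℝ, ℂ)) : ∫ ξ, 𝓕⁻ θ ξ = θ 0 := by
  have h : 𝓕 (𝓕⁻ θ) 0 = θ 0 := by rw [fourier_fourierInv_eq]
  rw [← h, fourier_apply_eq]
  simp

/-- Pointwise enlargement of supports passes to topological supports. -/
lemma tsupport_subset_cthickening {φ χ : 𝓢(ℝ, ℂ)} {δ : ℝ}
    (h : ∀ x, (∀ y, |y| < δ → φ (x - y) = 0) → χ x = 0) :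
    tsupport χ ⊆ Metric.cthickening δ (tsupport φ) := by
  refine closure_minimal (fun x hx ↦ ?_) Metric.isClosed_cthickening
  by_contra hx'
  refine hx (h x fun y hy ↦ image_eq_zero_of_notMem_tsupport fun hy' ↦ hx' ?_)
  exact Metric.mem_cthickening_of_dist_le x (x - y) δ _ hy' (by simpa [Real.dist_eq] using hy.le)

/-- The symbol of order `r` is a multiple of that of order `s ≥ r` by a local symbol, up to a
bounded error. -/
lemma exists_local_factor {r s : ℝ} (hr : r ≤ s) (θ : 𝓢(ℝ, ℂ)) (hθ : θ 0 = 1) :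
    ∃ h q : ℝ → ℂ, Continuous h ∧ (∃ C, ∀ ξ, ‖h ξ‖ ≤ C) ∧
      (smoothing (𝓕⁻ θ) h).HasTemperateGrowth ∧ (∃ C, ∀ ξ, ‖smoothing (𝓕⁻ θ) h ξ‖ ≤ C) ∧
      q.HasTemperateGrowth ∧ (∃ C, ∀ ξ, ‖q ξ‖ ≤ C) ∧
      besselSymbol r = besselSymbol s * smoothing (𝓕⁻ θ) h + q := by
  obtain ⟨m, hm, hm0⟩ := exists_isSymbol_besselSymbol (r - s)
  -- The error `q` has order `s + (r - s - k) = r - k`, so `k ≥ r` makes it bounded.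
  obtain ⟨k, hk⟩ := exists_nat_ge r
  have hrs : r - s ≤ 0 := by linarith
  have hrsk : r - s - k ≤ 0 := by linarith [k.cast_nonneg (α := ℝ)]
  obtain ⟨h, e, hh, he, heq⟩ :=
    hm.exists_smoothing_add (𝓕⁻ θ) (by rw [integral_fourierInv, hθ]) hrs k
  obtain ⟨C, -, hC⟩ := hh.bounded hrs 0
  obtain ⟨A, hA0, hA⟩ := norm_besselSymbol_le s
  obtain ⟨B, hB⟩ := he.bound 0
  have he' : (e 0).HasTemperateGrowth := hasTemperateGrowth_of_hasDerivAt he.hasDerivAt fun j ↦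
    (he.bounded hrsk j).imp fun _ h ↦ h.2
  refine ⟨h 0, besselSymbol s * e 0, hh.continuous 0, ⟨C, hC⟩,
    hh.smoothing_hasTemperateGrowth _ hrs, hh.smoothing_bounded _ hrs 0,
    (besselSymbol_hasTemperateGrowth s).mul he', ⟨A * |B|, fun ξ ↦ ?_⟩, ?_⟩
  · rw [Pi.mul_apply, norm_mul]
    have h1 : (1 + |ξ|) ^ s * (1 + |ξ|) ^ (r - s - k - (0 : ℕ)) ≤ 1 := by
      rw [← Real.rpow_add (by positivity)]
      exact Real.rpow_le_one_of_one_le_of_nonpos (by linarith [abs_nonneg ξ])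
        (by push_cast; linarith)
    have h2 : ‖e 0 ξ‖ ≤ |B| * (1 + |ξ|) ^ (r - s - k - (0 : ℕ)) :=
      (hB ξ).trans (by gcongr; exact le_abs_self B)
    calc _ ≤ (A * (1 + |ξ|) ^ s) * (|B| * (1 + |ξ|) ^ (r - s - k - (0 : ℕ))) :=
          mul_le_mul (hA ξ) h2 (norm_nonneg _) (by positivity)
      _ = A * |B| * ((1 + |ξ|) ^ s * (1 + |ξ|) ^ (r - s - k - (0 : ℕ))) := by ring
      _ ≤ A * |B| * 1 := by gcongr
      _ = _ := mul_one _
  · ext ξ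
    have h3 := besselSymbol_mul s (r - s) ξ
    rw [← hm0, heq ξ, add_sub_cancel] at h3
    rw [← h3]
    simp [mul_add]

lemma norm_integral_mul_le {U : Set ℝ} {g : ℝ → ℂ} (hg : MemLp g 2 (volume.restrict U)) :
    ∃ C, 0 ≤ C ∧ ∀ φ : 𝓢(ℝ, ℂ), ‖∫ x in U, φ x * g x‖ ≤ C * ‖φ.toLp 2 volume‖ := by
  refine ⟨(eLpNorm g 2 (volume.restrict U)).toReal, ENNReal.toReal_nonneg, fun φ ↦ ?_⟩
  have hφ : MemLp φ 2 (volume.restrict U) := (φ.memLp 2 volume).restrict U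
  have h1 : ∫ x in U, φ x * g x = inner ℂ hg.star.toLp (hφ.toLp φ) := by
    rw [L2.inner_def]
    refine integral_congr_ae ?_
    filter_upwards [hφ.coeFn_toLp, hg.star.coeFn_toLp] with x h2 h3
    rw [h2, h3]
    simp
  rw [h1]
  refine (norm_inner_le_norm _ _).trans ?_
  rw [Lp.norm_toLp, Lp.norm_toLp, SchwartzMap.norm_toLp, eLpNorm_star (f := g)]
  gcongr
  · exact (φ.memLp 2 volume).eLpNorm_ne_top
  · exact Measure.restrict_le_self

end OneSidedRegularity

end

theorem mainTheorem2 (f : Lp ℂ 2 (volume : Measure ℝ)) (s a : ℝ) (hs : 0 < s)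
    (hf : OneSidedRegularity.MemL2On (OneSidedRegularity.besselJ s (f : 𝓢'(ℝ, ℂ))) (Ioi a)) :
    ∀ ε : ℝ, 0 < ε → ∀ r : ℝ, r ∈ Ioc 0 s →
      OneSidedRegularity.MemL2On (OneSidedRegularity.besselJ r (f : 𝓢'(ℝ, ℂ)))
        (Ioi (a + ε)) := by
  open OneSidedRegularity in
  intro ε hε r hr
  obtain ⟨θ, hθ0, hθ⟩ := exists_schwartz_bump (half_pos hε)
  obtain ⟨h, q, hh, ⟨C, hC⟩, hp, ⟨P, hP⟩, hq, ⟨Q, hQ⟩, heq⟩ := exists_local_factor hr.2 θ hθ0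
  obtain ⟨g, hg, hgu⟩ := hf
  obtain ⟨G, hG0, hG⟩ := norm_integral_mul_le hg
  obtain ⟨F, hF0, hF⟩ : ∃ F, 0 ≤ F ∧ ∀ φ : 𝓢(ℝ, ℂ),
      ‖(f : 𝓢'(ℝ, ℂ)) φ‖ ≤ F * ‖φ.toLp 2 volume‖ := by
    obtain ⟨F, hF0, hF⟩ := norm_integral_mul_le (U := univ) (by simpa using Lp.memLp f)
    refine ⟨F, hF0, fun φ ↦ ?_⟩
    rw [Lp.toTemperedDistribution_apply]
    simpa using hF φ
  refine memL2On_of_norm_le (C := G * P + F * Q) fun φ hφ hφU ↦ ?_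
  have hsupp : tsupport (transposeMultiplier (smoothing (FourierTransform.fourierInv θ) h) φ) ⊆
      Metric.cthickening (ε / 2) (tsupport φ) :=
    tsupport_subset_cthickening fun x hx ↦
      transposeMultiplier_smoothing_eq_zero θ φ hh hC hp fun y ↦ by
        rcases lt_or_ge |y| (ε / 2) with hy | hy
        · rw [hx y hy, mul_zero]
        · rw [hθ y hy, zero_mul]
  -- The `J^s` factor is moved back onto `f`, so that the hypothesis applies to the enlarged test
  -- function.
  rw [besselJ_apply, heq,
    transposeMultiplier_add ((besselSymbol_hasTemperateGrowth s).mul hp) hq,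
    transposeMultiplier_mul (besselSymbol_hasTemperateGrowth s) hp, map_add, ← besselJ_apply,
    hgu _ (HasCompactSupport.of_support_subset_isCompact hφ.cthickening
      (subset_closure.trans hsupp)) (hsupp.trans fun x hx ↦ ?_)]
  · calc _ ≤ G * (P * ‖φ.toLp 2 volume‖) + F * (Q * ‖φ.toLp 2 volume‖) := by
          refine (norm_add_le _ _).trans (add_le_add ?_ ?_)
          · exact (hG _).trans (by gcongr; exact norm_transposeMultiplier_toLp_le hp hP φ)
          · exact (hF _).trans (by gcongr; exact norm_transposeMultiplier_toLp_le hq hQ φ)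
      _ = _ := by ring
  -- Points within `ε / 2` of the support of `φ` still exceed `a + ε / 2`.
  · rw [hφ.cthickening_eq_biUnion_closedBall (half_pos hε).le] at hx
    obtain ⟨y, hy, hxy⟩ := mem_iUnion₂.1 hx
    have h1 : a + ε < y := hφU hy
    have h2 := abs_le.1 (Real.dist_eq x y ▸ Metric.mem_closedBall.1 hxy)
    exact mem_Ioi.2 (by linarith [h2.1])
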